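/- Let $H$ be a finite-dimensional complex Hilbert space, let $\rho,\sigma$ be positive semi-definite operators on $H$ (no support condition is assumed), and let $\alpha\in(0,1)$. For $\beta>-1$, an $m$-point Gauss--Jacobi quadrature rule on $[0,1]$ with weight function $t^{\beta}$ consists of $m$ distinct real nodes $t_1<\dots<t_m$ and real weights $w_1,\dots,w_m$ such that $\int_0^1 p(t)\,t^{\beta}\,dt=\sum_{i=1}^m w_i\,p(t_i)$ for every real polynomial $p$ of degree at most $2m-1$. For every $m\in\mathbb{N}$, there exist $m$-point Gauss--Jacobi rules $(t_i,w_i)_{i=1}^m$ for the weight function $t^{\alpha-1}$ and $(t_i',w_i')_{i=1}^m$ for the weight function $t^{-\alpha}$ on $[0,1]$. For any such rules, all the nodes satisfy $t_i,t_i'\in(0,1)$, all the weights satisfy $w_i,w_i'>0$, and $$ \begin{aligned} \operatorname{Tr}\left[\rho^{\alpha}\sigma^{1-\alpha}\right]\ \geq\ &\frac{\sin(\alpha\pi)}{\pi}\sum_{i=1}^{m}\frac{w_i}{t_i}\inf_{Z}\left(\operatorname{Tr}\left[\rho Z^\dagger Z\right]+\operatorname{Tr}\left[\sigma\left(t_i(\mathbb{1}+Z)(\mathbb{1}+Z^\dagger)\right)\right]\right)\\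 &+\frac{\sin(\alpha\pi)}{\pi}\sum_{i=1}^{m}\frac{w_i'}{t_i'}\inf_{Z'}\left(\operatorname{Tr}\left[\rho\left(t_i'(\mathbb{1}+Z'^\dagger)(\mathbb{1}+Z')\right)\right]+\operatorname{Tr}\left[\sigma Z'Z'^\dagger\right]\right), \end{aligned} $$ where the infima range over all linear operators $Z,Z'$ on $H$. Moreover, as $m\to\infty$, the right-hand side converges to $\operatorname{Tr}[\rho^{\alpha}\sigma^{1-\alpha}]$. -/

import Mathlib

open Filter Topology Set

open scoped ComplexOrder

noncomputable section

/-- `IsGaussJacobi β t w`: the nodes `t` and the weights `w` form the `m`-point Gauss quadrature rule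
on `[0, 1]` for the Jacobi weight function `t ↦ t ^ β` (with `β > -1`): there are `m` distinct nodes,
listed in increasing order, and the rule integrates every polynomial of degree at most
`2 * m - 1` exactly. -/
structure IsGaussJacobi (β : ℝ) {m : ℕ} (t w : Fin m → ℝ) : Prop where
  strictMono : StrictMono t
  exact : ∀ p : Polynomial ℝ, p.degree < ((2 * m : ℕ) : WithBot ℕ) →
    ∫ x in (0 : ℝ)..1, p.eval x * x ^ β = ∑ i, w i * p.eval (t i)

section Variational

variable {H : Type*} [NormedAddCommGroup H] [InnerProductSpace ℂ H]

/-- The trace of an operator on a (finite-dimensional) Hilbert space. -/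
def opTrace (A : H →L[ℂ] H) : ℂ := LinearMap.trace ℂ H (A : H →ₗ[ℂ] H)

variable [CompleteSpace H]

/-- `Tr[ρ Z† Z] + Tr[σ (t (1 + Z) (1 + Z†))]`, a nonnegative real number for positive semi-definite
`ρ`, `σ` and `t ≥ 0`. -/
def objective₁ (ρ σ : H →L[ℂ] H) (t : ℝ) (Z : H →L[ℂ] H) : ℝ :=
  (opTrace (ρ * (star Z * Z)) + opTrace (σ * ((t : ℂ) • ((1 + Z) * (1 + star Z))))).re

/-- `Tr[ρ (t (1 + Z†) (1 + Z))] + Tr[σ Z Z†]`, a nonnegative real number for positive semi-definite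
`ρ`, `σ` and `t ≥ 0`. -/
def objective₂ (ρ σ : H →L[ℂ] H) (t : ℝ) (Z : H →L[ℂ] H) : ℝ :=
  (opTrace (ρ * ((t : ℂ) • ((1 + star Z) * (1 + Z)))) + opTrace (σ * (Z * star Z))).re

theorem opTrace_mul_star_nonneg [FiniteDimensional ℂ H] {ρ : H →L[ℂ] H} (hρ : ρ.IsPositive)
    (Z : H →L[ℂ] H) : 0 ≤ opTrace (ρ * (star Z * Z)) := by
  have h1 : opTrace (ρ * (star Z * Z)) = opTrace (Z * ρ * star Z) := by
    unfold opTrace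
    rw [← mul_assoc]
    have := LinearMap.trace_mul_comm ℂ ((ρ * star Z : H →L[ℂ] H) : H →ₗ[ℂ] H) (Z : H →ₗ[ℂ] H)
    simpa [mul_assoc] using this
  rw [h1]
  have h2 : (Z * ρ * star Z).IsPositive := hρ.conj_adjoint Z
  exact ((ContinuousLinearMap.isPositive_toLinearMap_iff _).2 h2).trace_nonneg

/-- The objective functions are bounded below, so that their infima are genuine infima. -/
theorem objective_nonneg [FiniteDimensional ℂ H] {ρ σ : H →L[ℂ] H} (hρ : ρ.IsPositive)
    (hσ : σ.IsPositive) {t : ℝ} (ht : 0 ≤ t) (Z : H →L[ℂ] H) :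
    0 ≤ objective₁ ρ σ t Z ∧ 0 ≤ objective₂ ρ σ t Z := by
  have hc : ∀ A B : H →L[ℂ] H, opTrace (A * ((t : ℂ) • B)) = t * opTrace (A * B) := by
    intro A B
    simp [opTrace]
  have ht' : (0 : ℂ) ≤ t := by exact_mod_cast ht
  have e1 := opTrace_mul_star_nonneg hρ Z
  have e2 := opTrace_mul_star_nonneg hσ (1 + star Z)
  have e3 := opTrace_mul_star_nonneg hρ (1 + Z)
  have e4 := opTrace_mul_star_nonneg hσ (star Z)
  simp only [star_add, star_one, star_star] at e2 e3 e4
  unfold objective₁ objective₂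
  rw [hc, hc]
  exact ⟨(Complex.le_def.1 (add_nonneg e1 (mul_nonneg ht' e2))).1,
    (Complex.le_def.1 (add_nonneg (mul_nonneg ht' e3) e4)).1⟩

/-- The variational expression obtained from nodes `t`, `t'` and weights `w`, `w'`. -/
def variationalBound (ρ σ : H →L[ℂ] H) (α : ℝ) {m : ℕ} (t w t' w' : Fin m → ℝ) : ℝ :=
  Real.sin (α * Real.pi) / Real.pi *
      (∑ i, (w i / t i) * (⨅ Z : H →L[ℂ] H, objective₁ ρ σ (t i) Z))
    + Real.sin (α * Real.pi) / Real.pi *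
      (∑ i, (w' i / t' i) * (⨅ Z : H →L[ℂ] H, objective₂ ρ σ (t' i) Z))

end Variational

end

/-! In eigenbases `e` of `ρ` and `f` of `σ`, both sides become double sums over pairs of eigenvalues
`(a, b)` with the same nonnegative weights `‖⟨f k, e j⟩‖ ^ 2`. For the trace this is
`opTrace_rpow_mul_rpow`. For the infima, the objectives are sums of functions of the separate matrix
entries of `Z`, so each entry is minimised alone (`iInf_decoupled`, `variationalBound_eq`).

What remains is scalar. A Beta integral writes `a ^ α * b ^ (1 - α)` as two integrals over `[0, 1]`
of `(a + t b)⁻¹` and `(b + t a)⁻¹` against the two Jacobi weights (`rpow_mul_rpow_eq_integral`), and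
`scalarBound` is their quadrature. Gauss rules underestimate such integrands (`sum_inv_le`), which
gives the inequality, and converge on continuous functions (`tendsto_gaussJacobi`), which gives the
limit. Existence of the rules is the classical argument with zeros of orthogonal polynomials. -/

/-! ### The Jacobi weight as a positive functional on polynomials -/

theorem intervalIntegrable_mul_rpow {β : ℝ} (hβ : -1 < β) {f : ℝ → ℝ}
    (hf : ContinuousOn f (Icc 0 1)) :
    IntervalIntegrable (fun x => f x * x ^ β) MeasureTheory.volume 0 1 := by
  refine (intervalIntegral.intervalIntegrable_rpow' hβ).continuousOn_mul ?_
  rwa [uIcc_of_le zero_le_one]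

/-- Integration of a polynomial over `[0, 1]` against the weight `x ^ β`. -/
noncomputable def jacobiFunctional {β : ℝ} (hβ : -1 < β) : Polynomial ℝ →ₗ[ℝ] ℝ where
  toFun p := ∫ x in (0 : ℝ)..1, p.eval x * x ^ β
  map_add' p q := by
    rw [← intervalIntegral.integral_add (intervalIntegrable_mul_rpow hβ p.continuousOn)
      (intervalIntegrable_mul_rpow hβ q.continuousOn)]
    simp only [Polynomial.eval_add, add_mul]
  map_smul' c p := by
    simp only [Polynomial.eval_smul, smul_eq_mul, mul_assoc, RingHom.id_apply,
      intervalIntegral.integral_const_mul]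

theorem jacobiFunctional_apply {β : ℝ} (hβ : -1 < β) (p : Polynomial ℝ) :
    jacobiFunctional hβ p = ∫ x in (0 : ℝ)..1, p.eval x * x ^ β := rfl

/-- The weight is positive on the open interval, and a nonzero polynomial vanishes only on a finite,
hence null, set. -/
theorem jacobiFunctional_pos {β : ℝ} (hβ : -1 < β) {p : Polynomial ℝ} (hp : p ≠ 0)
    (h : ∀ x ∈ Ioo (0 : ℝ) 1, 0 ≤ p.eval x) : 0 < jacobiFunctional hβ p := by
  rw [jacobiFunctional_apply, intervalIntegral.integral_of_le zero_le_one,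
    MeasureTheory.integral_Ioc_eq_integral_Ioo]
  have hint := ((intervalIntegrable_iff_integrableOn_Ioo_of_le zero_le_one).1
    (intervalIntegrable_mul_rpow hβ p.continuousOn))
  rw [MeasureTheory.setIntegral_pos_iff_support_of_nonneg_ae _ hint]
  · have hsub : Ioo (0 : ℝ) 1 \ (p.roots.toFinset : Set ℝ) ⊆
        Function.support (fun x => p.eval x * x ^ β) ∩ Ioo 0 1 := by
      rintro x ⟨hx, hr⟩
      refine ⟨?_, hx⟩
      have : p.eval x ≠ 0 := by simpa [hp] using hr
      exact mul_ne_zero this (Real.rpow_pos_of_pos hx.1 _).ne'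
    refine lt_of_lt_of_le ?_ (MeasureTheory.measure_mono hsub)
    rw [MeasureTheory.measure_sdiff_null (Finset.measure_zero _ _)]
    simp
  · filter_upwards [MeasureTheory.ae_restrict_mem measurableSet_Ioo] with x hx
    exact mul_nonneg (h x hx) (Real.rpow_nonneg hx.1.le _)

theorem jacobiFunctional_ne_zero {β : ℝ} (hβ : -1 < β) {p : Polynomial ℝ} (hp : p ≠ 0)
    (h : (∀ x ∈ Ioo (0 : ℝ) 1, 0 ≤ p.eval x) ∨ ∀ x ∈ Ioo (0 : ℝ) 1, p.eval x ≤ 0) :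
    jacobiFunctional hβ p ≠ 0 := by
  rcases h with h | h
  · exact (jacobiFunctional_pos hβ hp h).ne'
  · have := jacobiFunctional_pos hβ (neg_ne_zero.2 hp) (by simpa using h)
    rw [map_neg] at this
    linarith

/-- The square of the nodal polynomial with the factor of the node `i` left out. -/
noncomputable def nodalSq {m : ℕ} (t : Fin m → ℝ) (i : Fin m) : Polynomial ℝ :=
  (∏ j ∈ Finset.univ.erase i, (Polynomial.X - Polynomial.C (t j))) ^ 2

theorem nodalSq_monic {m : ℕ} (t : Fin m → ℝ) (i : Fin m) : (nodalSq t i).Monic :=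
  (Polynomial.monic_prod_of_monic _ _ fun _ _ => Polynomial.monic_X_sub_C _).pow 2

theorem nodalSq_natDegree {m : ℕ} (t : Fin m → ℝ) (i : Fin m) :
    (nodalSq t i).natDegree + 2 = 2 * m := by
  have hm : 0 < m := i.pos
  rw [nodalSq, Polynomial.natDegree_pow,
    Polynomial.natDegree_prod_of_monic _ _ fun _ _ => Polynomial.monic_X_sub_C _]
  simp
  omega

theorem nodalSq_eval_nonneg {m : ℕ} (t : Fin m → ℝ) (i : Fin m) (x : ℝ) :
    0 ≤ (nodalSq t i).eval x := by
  rw [nodalSq, Polynomial.eval_pow]; positivity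

theorem nodalSq_eval_ne {m : ℕ} (t : Fin m → ℝ) {i j : Fin m} (h : j ≠ i) :
    (nodalSq t i).eval (t j) = 0 := by
  rw [nodalSq, Polynomial.eval_pow, Polynomial.eval_prod,
    Finset.prod_eq_zero (i := j) (by simp [h]) (by simp)]
  simp

/-! ### Nodes, weights and error of a Gauss rule -/

namespace IsGaussJacobi

variable {β : ℝ} {m : ℕ} {t w : Fin m → ℝ}

theorem functional_eq (h : IsGaussJacobi β t w) (hβ : -1 < β) (p : Polynomial ℝ)
    (hp : p.degree < ((2 * m : ℕ) : WithBot ℕ)) :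
    jacobiFunctional hβ p = ∑ i, w i * p.eval (t i) := h.exact p hp

/-- The nodal polynomial times its cofactor at `i` has degree `2m - 1` and vanishes at every node,
so its integral is zero. A node outside `(0, 1)` would give it constant sign there. -/
theorem node_mem (h : IsGaussJacobi β t w) (hβ : -1 < β) (i : Fin m) : t i ∈ Ioo (0 : ℝ) 1 := by
  have hX : (Polynomial.X - Polynomial.C (t i)).Monic := Polynomial.monic_X_sub_C _
  have hmon : (nodalSq t i * (Polynomial.X - Polynomial.C (t i))).Monic := (nodalSq_monic t i).mul hX
  have hdeg : (nodalSq t i * (Polynomial.X - Polynomial.C (t i))).degree <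
      ((2 * m : ℕ) : WithBot ℕ) := by
    rw [Polynomial.degree_eq_natDegree hmon.ne_zero, (nodalSq_monic t i).natDegree_mul hX,
      Polynomial.natDegree_X_sub_C]
    have := nodalSq_natDegree t i
    exact_mod_cast (by omega : (nodalSq t i).natDegree + 1 < 2 * m)
  have hz := h.functional_eq hβ _ hdeg
  rw [Finset.sum_eq_zero] at hz
  · by_contra hcon
    refine jacobiFunctional_ne_zero hβ hmon.ne_zero ?_ hz
    simp only [Polynomial.eval_mul, Polynomial.eval_sub, Polynomial.eval_X, Polynomial.eval_C]
    rcases le_or_gt (t i) 0 with h0 | h0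
    · exact .inl fun x hx => mul_nonneg (nodalSq_eval_nonneg t i x) (by linarith [hx.1])
    · rcases le_or_gt 1 (t i) with h1 | h1
      · exact .inr fun x hx =>
          mul_nonpos_of_nonneg_of_nonpos (nodalSq_eval_nonneg t i x) (by linarith [hx.2])
      · exact absurd ⟨h0, h1⟩ hcon
  · intro j _
    by_cases hj : j = i
    · subst hj; simp
    · simp [nodalSq_eval_ne t hj]

/-- Exactness on `nodalSq t i`, of degree `2m - 2`, leaves only the term of node `i`. -/
theorem weight_pos (h : IsGaussJacobi β t w) (hβ : -1 < β) (i : Fin m) : 0 < w i := by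
  have hdeg : (nodalSq t i).degree < ((2 * m : ℕ) : WithBot ℕ) := by
    rw [Polynomial.degree_eq_natDegree (nodalSq_monic t i).ne_zero]
    have := nodalSq_natDegree t i
    exact_mod_cast (by omega : (nodalSq t i).natDegree < 2 * m)
  have hz := h.functional_eq hβ _ hdeg
  rw [Finset.sum_eq_single i (fun j _ hj => by simp [nodalSq_eval_ne t hj]) (by simp)] at hz
  have hpos := jacobiFunctional_pos hβ (nodalSq_monic t i).ne_zero
    fun x _ => nodalSq_eval_nonneg t i x
  rw [hz] at hpos
  exact pos_of_mul_pos_left hpos (nodalSq_eval_nonneg t i _)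

/-- A Gauss rule underestimates the integral of `x ↦ (a + x b)⁻¹`, by the remainder formula for
Hermite interpolation. -/
theorem sum_inv_le (h : IsGaussJacobi β t w) (hβ : -1 < β) {a b : ℝ} (ha : 0 < a) (hb : 0 < b) :
    ∑ i, w i * (a + t i * b)⁻¹ ≤ ∫ x in (0 : ℝ)..1, (a + x * b)⁻¹ * x ^ β := by
  set P : Polynomial ℝ := ∏ i, (Polynomial.X - Polynomial.C (t i)) with hP
  have hPmon : P.Monic := Polynomial.monic_prod_of_monic _ _ fun _ _ => Polynomial.monic_X_sub_C _
  have hPdeg : P.natDegree = m := by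
    rw [hP, Polynomial.natDegree_prod_of_monic _ _ fun _ _ => Polynomial.monic_X_sub_C _]
    simp
  -- The pole of the integrand.
  set s : ℝ := -(a / b) with hs
  have hs0 : s < 0 := by rw [hs]; exact neg_neg_of_pos (by positivity)
  have hPs : P.eval s ≠ 0 := by
    rw [hP, Polynomial.eval_prod, Finset.prod_ne_zero_iff]
    intro i _
    have := (h.node_mem hβ i).1
    simp only [Polynomial.eval_sub, Polynomial.eval_X, Polynomial.eval_C]
    linarith
  -- Normalised so that `1 - c P²` vanishes at the pole; dividing by `a + x b` then leaves a
  -- polynomial `r`, the Hermite interpolant at the nodes, with error `c P² / (a + x b) ≥ 0`.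
  set c : ℝ := ((P.eval s) ^ 2)⁻¹ with hc
  have hc0 : 0 ≤ c := by positivity
  obtain ⟨q, hq⟩ : (Polynomial.X - Polynomial.C s) ∣ (1 - Polynomial.C c * P ^ 2) := by
    rw [Polynomial.dvd_iff_isRoot, Polynomial.IsRoot.def]
    simp [hc, hPs]
  have hqeval : ∀ x, 1 - c * (P.eval x) ^ 2 = (x - s) * q.eval x := fun x => by
    simpa using congrArg (Polynomial.eval x) hq
  have hfac : ∀ x, a + x * b = b * (x - s) := fun x => by rw [hs]; field_simp; ring
  set r : Polynomial ℝ := Polynomial.C b⁻¹ * q with hr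
  have hreval : ∀ x, 0 ≤ x → r.eval x = (a + x * b)⁻¹ - c * (P.eval x) ^ 2 * (a + x * b)⁻¹ := by
    intro x hx
    have hxs : x - s ≠ 0 := by linarith
    have h1 : q.eval x = (1 - c * (P.eval x) ^ 2) / (x - s) := by
      rw [hqeval, mul_div_cancel_left₀ _ hxs]
    rw [hr, Polynomial.eval_mul, Polynomial.eval_C, h1, hfac]
    field_simp
  have hrdeg : r.degree < ((2 * m : ℕ) : WithBot ℕ) := by
    -- The case `q = 0` occurs only for `m = 0`, where the bound on `degree` needs `⊥ < 0`.
    rcases eq_or_ne q 0 with h0 | h0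
    · rw [hr, h0, mul_zero, Polynomial.degree_zero]
      exact WithBot.bot_lt_coe _
    · have h1 : (1 - Polynomial.C c * P ^ 2).natDegree ≤ 2 * m := by
        refine (Polynomial.natDegree_sub_le _ _).trans (max_le (by simp) ?_)
        refine (Polynomial.natDegree_C_mul_le _ _).trans ?_
        rw [Polynomial.natDegree_pow, hPdeg]
      rw [hq, (Polynomial.monic_X_sub_C s).natDegree_mul' h0, Polynomial.natDegree_X_sub_C] at h1
      have h2 : r.natDegree ≤ q.natDegree := Polynomial.natDegree_C_mul_le _ _
      refine lt_of_le_of_lt Polynomial.degree_le_natDegree ?_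
      exact_mod_cast (by omega : r.natDegree < 2 * m)
  have hnode : ∀ i, r.eval (t i) = (a + t i * b)⁻¹ := by
    intro i
    have : P.eval (t i) = 0 := by
      rw [hP, Polynomial.eval_prod, Finset.prod_eq_zero (Finset.mem_univ i) (by simp)]
    rw [hreval _ (h.node_mem hβ i).1.le, this]; simp
  have hsum := h.exact r hrdeg
  simp only [hnode] at hsum
  rw [← hsum]
  refine intervalIntegral.integral_mono_on zero_le_one
    (intervalIntegrable_mul_rpow hβ r.continuousOn) (intervalIntegrable_mul_rpow hβ ?_) ?_
  · refine ContinuousOn.inv₀ (by fun_prop) fun x hx => ?_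
    have := hx.1
    positivity
  · intro x hx
    have hx0 := hx.1
    refine mul_le_mul_of_nonneg_right ?_ (Real.rpow_nonneg hx0 _)
    rw [hreval x hx0]
    have : 0 ≤ c * (P.eval x) ^ 2 * (a + x * b)⁻¹ := by positivity
    linarith

end IsGaussJacobi

/-- Gauss rules converge on continuous functions. -/
theorem tendsto_gaussJacobi {β : ℝ} (hβ : -1 < β) {t w : (m : ℕ) → Fin m → ℝ}
    (h : ∀ m, IsGaussJacobi β (t m) (w m)) {f : ℝ → ℝ} (hf : ContinuousOn f (Icc 0 1)) :
    Tendsto (fun m => ∑ i, w m i * f (t m i)) atTop (𝓝 (∫ x in (0 : ℝ)..1, f x * x ^ β)) := by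
  set M := jacobiFunctional hβ 1 with hM
  have hM0 : 0 < M := jacobiFunctional_pos hβ one_ne_zero (by simp)
  have hMint : M = ∫ x in (0 : ℝ)..1, x ^ β := by simp [hM, jacobiFunctional_apply]
  rw [Metric.tendsto_atTop]
  intro ε hε
  -- Weierstrass approximation. The weights are positive with sum `M`, so replacing `f` by `p` costs
  -- at most `ε / 4` in the sum and in the integral.
  obtain ⟨p, hp⟩ := exists_polynomial_near_of_continuousOn 0 1 f hf (ε / (4 * M)) (by positivity)
  refine ⟨p.natDegree + 1, fun m hm => ?_⟩
  have hpdeg : p.degree < ((2 * m : ℕ) : WithBot ℕ) :=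
    lt_of_le_of_lt Polynomial.degree_le_natDegree
      (by exact_mod_cast (by omega : p.natDegree < 2 * m))
  have h1deg : (1 : Polynomial ℝ).degree < ((2 * m : ℕ) : WithBot ℕ) := by
    rw [Polynomial.degree_one]
    exact_mod_cast (by omega : 0 < 2 * m)
  have hmass : ∑ i, w m i = M := by simpa using ((h m).functional_eq hβ 1 h1deg).symm
  have hex := (h m).exact p hpdeg
  have e1 : |∑ i, w m i * f (t m i) - ∑ i, w m i * p.eval (t m i)| ≤ ε / 4 := by
    rw [← Finset.sum_sub_distrib]
    calc |∑ i, (w m i * f (t m i) - w m i * p.eval (t m i))|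
        ≤ ∑ i, |w m i * f (t m i) - w m i * p.eval (t m i)| := Finset.abs_sum_le_sum_abs _ _
      _ ≤ ∑ i, w m i * (ε / (4 * M)) := by
        refine Finset.sum_le_sum fun i _ => ?_
        have hw := (h m).weight_pos hβ i
        rw [← mul_sub, abs_mul, abs_of_pos hw, abs_sub_comm]
        exact mul_le_mul_of_nonneg_left (hp _ (Ioo_subset_Icc_self ((h m).node_mem hβ i))).le hw.le
      _ = ε / 4 := by rw [← Finset.sum_mul, hmass]; field_simp
  have e2 : |(∫ x in (0 : ℝ)..1, p.eval x * x ^ β) - ∫ x in (0 : ℝ)..1, f x * x ^ β| ≤ ε / 4 := by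
    rw [← intervalIntegral.integral_sub (intervalIntegrable_mul_rpow hβ p.continuousOn)
      (intervalIntegrable_mul_rpow hβ hf)]
    have hb : IntervalIntegrable (fun x : ℝ => ε / (4 * M) * x ^ β) MeasureTheory.volume 0 1 :=
      intervalIntegrable_mul_rpow hβ continuousOn_const
    have := intervalIntegral.norm_integral_le_of_norm_le (μ := MeasureTheory.volume)
      (f := fun x => p.eval x * x ^ β - f x * x ^ β) zero_le_one
      (.of_forall fun x hx => ?_) hb
    · refine this.trans (le_of_eq ?_)
      rw [intervalIntegral.integral_const_mul, ← hMint]; field_simp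
    · rw [← sub_mul, norm_mul, Real.norm_eq_abs, Real.norm_of_nonneg (Real.rpow_nonneg hx.1.le _)]
      exact mul_le_mul_of_nonneg_right (hp x (Ioc_subset_Icc_self hx)).le
        (Real.rpow_nonneg hx.1.le _)
  rw [hex] at e2
  rw [Real.dist_eq]
  have := abs_sub_le (∑ i, w m i * f (t m i)) (∑ i, w m i * p.eval (t m i))
    (∫ x in (0 : ℝ)..1, f x * x ^ β)
  linarith

/-! ### Existence of Gauss rules -/

/-- The orthogonal polynomial of degree `m` for the weight `x ^ β` on `[0, 1]`. -/
theorem exists_monic_orthogonal {β : ℝ} (hβ : -1 < β) (m : ℕ) :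
    ∃ P : Polynomial ℝ, P.Monic ∧ P.natDegree = m ∧
      ∀ q : Polynomial ℝ, q.degree < m → jacobiFunctional hβ (P * q) = 0 := by
  let V := Polynomial.degreeLT ℝ m
  let B : V →ₗ[ℝ] V →ₗ[ℝ] ℝ :=
    ((LinearMap.mul ℝ (Polynomial ℝ)).compr₂ (jacobiFunctional hβ)).compl₁₂ V.subtype V.subtype
  have hB : ∀ p q : V, B p q = jacobiFunctional hβ (p * q) := fun _ _ => rfl
  have hfin : FiniteDimensional ℝ V :=
    Module.Finite.equiv (Polynomial.degreeLTEquiv ℝ m).symm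
  have hinj : Function.Injective B := by
    rw [← LinearMap.ker_eq_bot, LinearMap.ker_eq_bot']
    intro p hp
    by_contra hne
    have h1 : jacobiFunctional hβ ((p : Polynomial ℝ) * p) = 0 := by rw [← hB, hp]; rfl
    have hne' : (p : Polynomial ℝ) ≠ 0 := by simpa using hne
    exact (jacobiFunctional_pos hβ (mul_ne_zero hne' hne')
      fun x _ => by simpa using mul_self_nonneg _).ne' h1
  have hsurj : Function.Surjective B :=
    (LinearMap.injective_iff_surjective_of_finrank_eq_finrank
      (Subspace.dual_finrank_eq (K := ℝ) (V := V)).symm).1 hinj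
  -- The form `B` is positive definite, so `q ↦ ∫ X ^ m q` is represented by some `r`, the
  -- orthogonal projection of `X ^ m`.
  obtain ⟨r, hr⟩ := hsurj
    (((LinearMap.mul ℝ (Polynomial ℝ)).compr₂ (jacobiFunctional hβ) (Polynomial.X ^ m)).comp
      V.subtype)
  have hrdeg : (r : Polynomial ℝ).degree < m := Polynomial.mem_degreeLT.1 r.2
  refine ⟨Polynomial.X ^ m - (r : Polynomial ℝ), (Polynomial.monic_X_pow m).sub_of_left
    (by rwa [Polynomial.degree_X_pow]), ?_, ?_⟩
  · refine Polynomial.natDegree_eq_of_degree_eq_some ?_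
    rw [Polynomial.degree_sub_eq_left_of_degree_lt (by rwa [Polynomial.degree_X_pow]),
      Polynomial.degree_X_pow]
  · intro q hq
    have h1 := LinearMap.congr_fun hr ⟨q, Polynomial.mem_degreeLT.2 hq⟩
    have h2 : jacobiFunctional hβ ((r : Polynomial ℝ) * q) =
      jacobiFunctional hβ (Polynomial.X ^ m * q) := h1
    rw [sub_mul, map_sub, h2, sub_self]

/-- If `P = g h`, then `h` has degree below `m`, so `P h = g h²` integrates to zero although it has
the sign of `g`. -/
theorem no_constSign_dvd_orthogonal {β : ℝ} (hβ : -1 < β) {m : ℕ} {P : Polynomial ℝ}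
    (hP : P.Monic) (hm : P.natDegree = m)
    (horth : ∀ q : Polynomial ℝ, q.degree < m → jacobiFunctional hβ (P * q) = 0)
    {g : Polynomial ℝ} (hg : g ∣ P) (hdeg : 0 < g.natDegree) :
    ¬ ((∀ x ∈ Ioo (0 : ℝ) 1, 0 ≤ g.eval x) ∨ ∀ x ∈ Ioo (0 : ℝ) 1, g.eval x ≤ 0) := by
  intro hsign
  obtain ⟨h, rfl⟩ := hg
  have hne := mul_ne_zero_iff.1 hP.ne_zero
  have hh : h.degree < m := by
    rw [Polynomial.degree_eq_natDegree hne.2]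
    rw [Polynomial.natDegree_mul hne.1 hne.2] at hm
    exact_mod_cast (by omega : h.natDegree < m)
  refine jacobiFunctional_ne_zero hβ (mul_ne_zero hP.ne_zero hne.2) ?_ (horth h hh)
  refine hsign.imp (fun H x hx => ?_) (fun H x hx => ?_)
  · simpa [mul_assoc] using mul_nonneg (H x hx) (mul_self_nonneg (h.eval x))
  · simpa [mul_assoc] using mul_nonpos_of_nonpos_of_nonneg (H x hx) (mul_self_nonneg (h.eval x))

theorem constSign_of_no_root {g : Polynomial ℝ} {s : Set ℝ} (hs : IsPreconnected s)
    (h : ∀ x ∈ s, g.eval x ≠ 0) : (∀ x ∈ s, 0 ≤ g.eval x) ∨ ∀ x ∈ s, g.eval x ≤ 0 := by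
  by_contra! hcon
  obtain ⟨⟨x, hx, hx'⟩, y, hy, hy'⟩ := hcon
  obtain ⟨z, hz, hz0⟩ := hs.intermediate_value hx hy g.continuousOn ⟨hx'.le, hy'.le⟩
  exact h z hz hz0

/-- An irreducible factor that is not linear has no real root and so keeps its sign; a repeated root
gives a square factor. Both are excluded by `no_constSign_dvd_orthogonal`. -/
theorem card_roots_orthogonal {β : ℝ} (hβ : -1 < β) {m : ℕ} {P : Polynomial ℝ}
    (hP : P.Monic) (hm : P.natDegree = m)
    (horth : ∀ q : Polynomial ℝ, q.degree < m → jacobiFunctional hβ (P * q) = 0) :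
    P.roots.toFinset.card = m := by
  have hsplit : P.Splits := by
    obtain ⟨u, hu⟩ := UniqueFactorizationMonoid.factors_prod hP.ne_zero
    rw [← hu]
    refine (Polynomial.Splits.multisetProd fun g hmem => ?_).mul u.isUnit.splits
    have hg := UniqueFactorizationMonoid.irreducible_of_factor g hmem
    have hdvd := UniqueFactorizationMonoid.dvd_of_mem_factors hmem
    refine Polynomial.Splits.of_degree_eq_one ?_
    by_contra hdeg
    refine no_constSign_dvd_orthogonal hβ hP hm horth hdvd hg.natDegree_pos
      (constSign_of_no_root isPreconnected_Ioo fun x _ hx => hdeg ?_)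
    exact Polynomial.degree_eq_one_of_irreducible_of_root hg hx
  have hnodup : P.roots.Nodup := by
    rw [Multiset.nodup_iff_count_le_one]
    intro a
    rw [Polynomial.count_roots]
    by_contra! hlt
    have hdvd : (Polynomial.X - Polynomial.C a) ^ 2 ∣ P :=
      (pow_dvd_pow _ hlt).trans (Polynomial.pow_rootMultiplicity_dvd P a)
    refine no_constSign_dvd_orthogonal hβ hP hm horth hdvd (by simp) (.inl fun x _ => ?_)
    rw [Polynomial.eval_pow]; positivity
  rw [Multiset.toFinset_card_of_nodup hnodup, ← hm, ← hsplit.natDegree_eq_card_roots]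

/-- Nodes are the roots of `P`, weights the integrals of the Lagrange basis. Dividing `p` by `P`,
orthogonality kills the quotient term, and the remainder is interpolated exactly. -/
theorem exists_isGaussJacobi {β : ℝ} (hβ : -1 < β) (m : ℕ) :
    ∃ t w : Fin m → ℝ, IsGaussJacobi β t w := by
  obtain ⟨P, hP, hm, horth⟩ := exists_monic_orthogonal hβ m
  have hcard := card_roots_orthogonal hβ hP hm horth
  let t : Fin m → ℝ := P.roots.toFinset.orderEmbOfFin hcard
  have htm : StrictMono t := (P.roots.toFinset.orderEmbOfFin hcard).strictMono
  have hroot : ∀ i, P.eval (t i) = 0 := fun i => by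
    have h1 : t i ∈ P.roots.toFinset := Finset.orderEmbOfFin_mem _ hcard i
    simpa [hP.ne_zero] using h1
  refine ⟨t, fun i => jacobiFunctional hβ (Lagrange.basis Finset.univ t i), htm, fun p hp => ?_⟩
  have hr : (p %ₘ P).degree < m := by
    refine (Polynomial.degree_modByMonic_lt p hP).trans_le ?_
    rw [Polynomial.degree_eq_natDegree hP.ne_zero, hm]
  have hq : (p /ₘ P).degree < m := by
    rcases eq_or_ne (p /ₘ P) 0 with h0 | h0
    · rw [h0, Polynomial.degree_zero]; exact WithBot.bot_lt_coe _
    · have hp0 : p ≠ 0 := by rintro rfl; simp at h0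
      rw [Polynomial.degree_eq_natDegree h0, Polynomial.natDegree_divByMonic p hP, hm]
      rw [Polynomial.degree_eq_natDegree hp0] at hp
      have hp' : p.natDegree < 2 * m := by exact_mod_cast hp
      exact_mod_cast (by omega : p.natDegree - m < m)
  have hsplit : p = p %ₘ P + P * (p /ₘ P) := (Polynomial.modByMonic_add_div p P).symm
  have heval : ∀ i, p.eval (t i) = (p %ₘ P).eval (t i) := fun i => by
    conv_lhs => rw [hsplit]
    simp [hroot]
  rw [← jacobiFunctional_apply hβ, hsplit, map_add, horth _ hq, add_zero, ← hsplit,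
    Lagrange.eq_interpolate (s := Finset.univ) (v := t) htm.injective.injOn (f := p %ₘ P)
      (by simpa using hr), Lagrange.interpolate_apply, map_sum]
  refine Finset.sum_congr rfl fun i _ => ?_
  rw [← Polynomial.smul_eq_C_mul, map_smul, heval, smul_eq_mul, mul_comm]

/-! ### Integral representation of `a ^ α * b ^ (1 - α)` -/

/-- This is the Beta integral at `(α, 1 - α)`, evaluated by Euler's reflection formula. -/
theorem integral_beta_kernel {α : ℝ} (hα : α ∈ Ioo (0 : ℝ) 1) :
    IntervalIntegrable (fun x : ℝ => x ^ (α - 1) * (1 - x) ^ (-α)) MeasureTheory.volume 0 1 ∧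
    ∫ x in (0 : ℝ)..1, x ^ (α - 1) * (1 - x) ^ (-α) = Real.pi / Real.sin (α * Real.pi) := by
  have h0 : 0 < ((α : ℂ)).re := by simpa using hα.1
  have h1 : 0 < (1 - (α : ℂ)).re := by simpa using hα.2
  have hc : ∀ x ∈ Icc (0 : ℝ) 1, (x : ℂ) ^ ((α : ℂ) - 1) * (1 - (x : ℂ)) ^ ((1 - (α : ℂ)) - 1) =
      ((x ^ (α - 1) * (1 - x) ^ (-α) : ℝ) : ℂ) := by
    intro x hx
    rw [Complex.ofReal_mul, Complex.ofReal_cpow hx.1, Complex.ofReal_cpow (sub_nonneg.2 hx.2)]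
    push_cast
    congr 2
    ring
  have hconv := Complex.betaIntegral_convergent h0 h1
  have hbeta := Complex.Gamma_mul_Gamma_eq_betaIntegral h0 h1
  rw [Complex.Gamma_mul_Gamma_one_sub, add_sub_cancel, Complex.Gamma_one, one_mul,
    Complex.betaIntegral, intervalIntegral.integral_congr
      (g := fun x : ℝ => ((x ^ (α - 1) * (1 - x) ^ (-α) : ℝ) : ℂ))
      (fun x hx => hc x (by rwa [uIcc_of_le zero_le_one] at hx)),
    intervalIntegral.integral_ofReal] at hbeta
  constructor
  · rw [intervalIntegrable_iff_integrableOn_Icc_of_le zero_le_one] at hconv ⊢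
    have h2 := (hconv.congr_fun hc measurableSet_Icc).re
    simpa [MeasureTheory.IntegrableOn] using h2
  · have h3 : ((Real.pi / Real.sin (α * Real.pi) : ℝ) : ℂ) =
        (∫ x in (0 : ℝ)..1, x ^ (α - 1) * (1 - x) ^ (-α) : ℝ) := by
      rw [← hbeta, mul_comm α]; push_cast; rfl
    exact_mod_cast h3.symm

/-- The Möbius substitution `s = t b / (a + t b)`. -/
theorem integral_mobius (α : ℝ) {a b : ℝ} (ha : 0 < a) (hb : 0 < b) :
    ∫ t in (0 : ℝ)..1, (a * b * (a + t * b)⁻¹) * t ^ (α - 1) =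
      a ^ α * b ^ (1 - α) *
        ∫ s in (0 : ℝ)..(b / (a + b)), s ^ (α - 1) * (1 - s) ^ (-α) := by
  have hab : 0 < a + b := by positivity
  set φ : ℝ → ℝ := fun t => t * b / (a + t * b) with hφ
  have hpos : ∀ t ∈ Ioo (0 : ℝ) 1, 0 < a + t * b := fun t ht => by
    have := ht.1; positivity
  have hderiv : ∀ t ∈ Ioo (0 : ℝ) 1,
      HasDerivWithinAt φ (a * b / (a + t * b) ^ 2) (Ioo 0 1) t := by
    intro t ht
    have hp := (hpos t ht).ne'
    have h1 : HasDerivAt (fun t : ℝ => t * b) b t := by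
      simpa using (hasDerivAt_id t).mul_const b
    have h2 := h1.div (h1.const_add a) hp
    refine (h2.congr_deriv ?_).hasDerivWithinAt
    congr 1
    ring
  have hinj : InjOn φ (Ioo 0 1) := by
    intro x hx y hy hxy
    simp only [hφ] at hxy
    rw [div_eq_div_iff (hpos x hx).ne' (hpos y hy).ne'] at hxy
    have : a * b * (x - y) = 0 := by linear_combination hxy
    have h3 : a * b ≠ 0 := by positivity
    linarith [(mul_eq_zero.1 this).resolve_left h3]
  have himg : φ '' Ioo 0 1 = Ioo 0 (b / (a + b)) := by
    ext s
    constructor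
    · rintro ⟨t, ht, rfl⟩
      have hp := hpos t ht
      have ht0 := ht.1
      refine ⟨by simp only [hφ]; positivity, ?_⟩
      simp only [hφ]
      rw [div_lt_div_iff₀ hp hab]
      nlinarith [mul_pos (mul_pos ha hb) (sub_pos.2 ht.2)]
    · rintro ⟨hs0, hs1⟩
      rw [lt_div_iff₀ hab] at hs1
      have hs2 : s < 1 := by
        by_contra hge
        nlinarith
      have hs3 : 0 < 1 - s := by linarith
      -- Obtained by solving `s = t b / (a + t b)` for `t`.
      refine ⟨a * s / (b * (1 - s)), ⟨by positivity, ?_⟩, ?_⟩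
      · rw [div_lt_one (by positivity)]; nlinarith
      · simp only [hφ]; field_simp; ring
  have hsub := MeasureTheory.integral_image_eq_integral_abs_deriv_smul measurableSet_Ioo hderiv hinj
    (fun s => s ^ (α - 1) * (1 - s) ^ (-α))
  rw [himg] at hsub
  rw [intervalIntegral.integral_of_le zero_le_one, MeasureTheory.integral_Ioc_eq_integral_Ioo,
    intervalIntegral.integral_of_le (by positivity), MeasureTheory.integral_Ioc_eq_integral_Ioo,
    hsub, ← MeasureTheory.integral_const_mul]
  refine MeasureTheory.setIntegral_congr_fun measurableSet_Ioo fun t ht => ?_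
  have hp := hpos t ht
  have ht0 := ht.1
  have e1 : 1 - φ t = a / (a + t * b) := by simp only [hφ]; field_simp; ring
  have e2 : 0 ≤ a * b / (a + t * b) ^ 2 := by positivity
  simp only [smul_eq_mul]
  rw [e1, abs_of_nonneg e2]
  simp only [hφ]
  rw [Real.div_rpow (by positivity) hp.le, Real.div_rpow ha.le hp.le,
    Real.mul_rpow ht0.le hb.le, Real.rpow_neg ha.le, Real.rpow_neg hp.le, Real.rpow_sub_one hp.ne',
    Real.rpow_sub_one hb.ne', Real.rpow_sub hb, Real.rpow_one]
  have := Real.rpow_pos_of_pos ha α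
  have := Real.rpow_pos_of_pos hb α
  have := Real.rpow_pos_of_pos hp α
  field_simp

/-- `a ^ α * b ^ (1 - α)` as a sum of two integrals over `[0, 1]`. -/
theorem rpow_mul_rpow_eq_integral {α : ℝ} (hα : α ∈ Ioo (0 : ℝ) 1) {a b : ℝ}
    (ha : 0 < a) (hb : 0 < b) :
    Real.sin (α * Real.pi) / Real.pi *
      ((∫ t in (0 : ℝ)..1, (a * b * (a + t * b)⁻¹) * t ^ (α - 1)) +
        ∫ t in (0 : ℝ)..1, (a * b * (b + t * a)⁻¹) * t ^ (-α)) = a ^ α * b ^ (1 - α) := by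
  obtain ⟨hint, hval⟩ := integral_beta_kernel hα
  have hab : 0 < a + b := by positivity
  have h1 := integral_mobius α ha hb
  have h2 := integral_mobius (1 - α) hb ha
  -- The reflection `s ↦ 1 - s` moves the second integral to the complementary interval, so that the
  -- two add up to the full Beta integral.
  have hrefl : ∫ s in (0 : ℝ)..(a / (b + a)), s ^ (1 - α - 1) * (1 - s) ^ (-(1 - α)) =
      ∫ s in (b / (a + b))..1, s ^ (α - 1) * (1 - s) ^ (-α) := by
    have := intervalIntegral.integral_comp_sub_left
      (a := 0) (b := a / (b + a)) (fun s : ℝ => s ^ (α - 1) * (1 - s) ^ (-α)) 1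
    rw [sub_zero, show 1 - a / (b + a) = b / (a + b) by field_simp; ring] at this
    rw [← this]
    refine intervalIntegral.integral_congr fun s _ => ?_
    simp only [sub_sub_cancel]
    rw [mul_comm]
    congr 2 <;> ring
  rw [hrefl, show (1 - α - 1) = -α by ring, sub_sub_cancel] at h2
  have hmem : b / (a + b) ∈ Icc (0 : ℝ) 1 :=
    ⟨by positivity, by rw [div_le_one hab]; linarith⟩
  have hadd := intervalIntegral.integral_add_adjacent_intervals
    (hint.mono_set (c := 0) (d := b / (a + b)) (by
      rw [uIcc_of_le zero_le_one, uIcc_of_le hmem.1]; exact Icc_subset_Icc le_rfl hmem.2))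
    (hint.mono_set (c := b / (a + b)) (d := 1) (by
      rw [uIcc_of_le zero_le_one, uIcc_of_le hmem.2]; exact Icc_subset_Icc hmem.1 le_rfl))
  have hsin : 0 < Real.sin (α * Real.pi) :=
    Real.sin_pos_of_pos_of_lt_pi (mul_pos hα.1 Real.pi_pos) (by nlinarith [hα.2, Real.pi_pos])
  have hpi := Real.pi_pos
  rw [h1, show (fun t : ℝ => a * b * (b + t * a)⁻¹ * t ^ (-α)) =
    fun t : ℝ => b * a * (b + t * a)⁻¹ * t ^ (-α) by simp only [mul_comm a b], h2,
    mul_comm (b ^ (1 - α)), ← mul_add, hadd, hval]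
  field_simp

/-! ### Minimisation over a single matrix entry -/

/-- With `x = ‖z‖` and `y = ‖c + z‖`, one has `(A + B)(A x² + B y²) - A B (x + y)² = (A x - B y)²`,
and `‖c‖ ≤ x + y`. -/
theorem sq_mul_div_add_le {A B : ℝ} (hA : 0 ≤ A) (hB : 0 ≤ B) (c z : ℂ) :
    ‖c‖ ^ 2 * (A * B / (A + B)) ≤ A * ‖z‖ ^ 2 + B * ‖c + z‖ ^ 2 := by
  rcases (add_nonneg hA hB).eq_or_lt with h0 | h0
  · rw [← h0]; simp; positivity
  have hc : ‖c‖ ≤ ‖z‖ + ‖c + z‖ := by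
    calc ‖c‖ = ‖(c + z) - z‖ := by rw [add_sub_cancel_right]
      _ ≤ ‖c + z‖ + ‖z‖ := norm_sub_le _ _
      _ = _ := add_comm _ _
  have hc2 : ‖c‖ ^ 2 ≤ (‖z‖ + ‖c + z‖) ^ 2 := by gcongr
  rw [← mul_div_assoc, div_le_iff₀ h0]
  nlinarith [sq_nonneg (A * ‖z‖ - B * ‖c + z‖), mul_le_mul_of_nonneg_right hc2 (mul_nonneg hA hB)]

theorem sq_mul_div_add_eq {A B : ℝ} (hA : 0 ≤ A) (hB : 0 ≤ B) (c : ℂ) :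
    A * ‖((-(B / (A + B)) : ℝ) : ℂ) * c‖ ^ 2 + B * ‖c + ((-(B / (A + B)) : ℝ) : ℂ) * c‖ ^ 2 =
      ‖c‖ ^ 2 * (A * B / (A + B)) := by
  rcases (add_nonneg hA hB).eq_or_lt with h0 | h0
  · have hA0 : A = 0 := by linarith
    have hB0 : B = 0 := by linarith
    simp [hA0, hB0]
  have h1 : c + ((-(B / (A + B)) : ℝ) : ℂ) * c = ((A / (A + B) : ℝ) : ℂ) * c := by
    have h2 : ((A / (A + B) : ℝ) : ℂ) = 1 + ((-(B / (A + B)) : ℝ) : ℂ) := by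
      rw [← Complex.ofReal_one, ← Complex.ofReal_add]
      congr 1
      field_simp
      ring
    rw [h2]; ring
  rw [h1, norm_mul, norm_mul, Complex.norm_real, Complex.norm_real, mul_pow, mul_pow,
    Real.norm_eq_abs, Real.norm_eq_abs, sq_abs, sq_abs]
  field_simp
  ring

/-! ### Traces and objectives in the two eigenbases -/

section Trace

variable {H : Type*} [NormedAddCommGroup H] [InnerProductSpace ℂ H]

theorem opTrace_eq_sum_inner {ι : Type*} [Fintype ι] (e : OrthonormalBasis ι ℂ H) (A : H →L[ℂ] H) :
    opTrace A = ∑ i, inner ℂ (e i) (A (e i)) :=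
  LinearMap.trace_eq_sum_inner _ e

theorem opTrace_mul_comm (A B : H →L[ℂ] H) : opTrace (A * B) = opTrace (B * A) :=
  LinearMap.trace_mul_comm ℂ (A : H →ₗ[ℂ] H) (B : H →ₗ[ℂ] H)

theorem opTrace_mul_smul (A B : H →L[ℂ] H) (t : ℂ) : opTrace (A * (t • B)) = t * opTrace (A * B) := by
  simp [opTrace]

variable [CompleteSpace H]
variable {ι κ : Type*} [Fintype ι] [Fintype κ]
  (e : OrthonormalBasis ι ℂ H) (f : OrthonormalBasis κ ℂ H)
variable {ρ σ : H →L[ℂ] H} {a : ι → ℝ} {b : κ → ℝ}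

theorem opTrace_mul_star_mul {ρ : H →L[ℂ] H} {a : ι → ℝ} (he : ∀ j, ρ (e j) = (a j : ℂ) • e j)
    (W : H →L[ℂ] H) :
    opTrace (ρ * (star W * W)) =
      ((∑ j, ∑ k, a j * ‖inner ℂ (f k) (W (e j))‖ ^ 2 : ℝ) : ℂ) := by
  rw [opTrace_mul_comm, opTrace_eq_sum_inner e, Complex.ofReal_sum]
  refine Finset.sum_congr rfl fun j _ => ?_
  rw [← Finset.mul_sum, f.sum_sq_norm_inner_right, mul_apply_eq_comp, he, map_smul,
    inner_smul_right, mul_apply_eq_comp, ContinuousLinearMap.star_eq_adjoint,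
    ContinuousLinearMap.adjoint_inner_right, inner_self_eq_norm_sq_to_K]
  push_cast
  rfl

/-- Applying the previous formula to `star W` with the bases exchanged keeps the same entries `⟨f k,
W e j⟩`, which is what lets the objectives decouple. -/
theorem opTrace_mul_mul_star {σ : H →L[ℂ] H} {b : κ → ℝ} (hf : ∀ k, σ (f k) = (b k : ℂ) • f k)
    (W : H →L[ℂ] H) :
    opTrace (σ * (W * star W)) =
      ((∑ j, ∑ k, b k * ‖inner ℂ (f k) (W (e j))‖ ^ 2 : ℝ) : ℂ) := by
  have h1 := opTrace_mul_star_mul f e hf (star W)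
  rw [star_star] at h1
  rw [h1, Finset.sum_comm]
  congr 1
  refine Finset.sum_congr rfl fun j _ => Finset.sum_congr rfl fun k _ => ?_
  rw [ContinuousLinearMap.star_eq_adjoint, ContinuousLinearMap.adjoint_inner_right,
    norm_inner_symm]

theorem objective₁_eq (he : ∀ j, ρ (e j) = (a j : ℂ) • e j) (hf : ∀ k, σ (f k) = (b k : ℂ) • f k)
    (t : ℝ) (Z : H →L[ℂ] H) :
    objective₁ ρ σ t Z = ∑ j, ∑ k, (a j * ‖inner ℂ (f k) (Z (e j))‖ ^ 2 +
      t * b k * ‖inner ℂ (f k) (e j) + inner ℂ (f k) (Z (e j))‖ ^ 2) := by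
  have h1 := opTrace_mul_mul_star e f hf (1 + Z)
  rw [star_add, star_one] at h1
  rw [objective₁, opTrace_mul_smul, opTrace_mul_star_mul e f he, h1, ← Complex.ofReal_mul,
    ← Complex.ofReal_add, Complex.ofReal_re]
  simp only [Finset.mul_sum, ← Finset.sum_add_distrib, add_apply,
    one_apply_eq_self, inner_add_right, mul_assoc]

theorem objective₂_eq (he : ∀ j, ρ (e j) = (a j : ℂ) • e j) (hf : ∀ k, σ (f k) = (b k : ℂ) • f k)
    (t : ℝ) (Z : H →L[ℂ] H) :
    objective₂ ρ σ t Z = ∑ j, ∑ k, (b k * ‖inner ℂ (f k) (Z (e j))‖ ^ 2 +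
      t * a j * ‖inner ℂ (f k) (e j) + inner ℂ (f k) (Z (e j))‖ ^ 2) := by
  have h1 := opTrace_mul_star_mul e f he (1 + Z)
  rw [star_add, star_one] at h1
  rw [objective₂, opTrace_mul_smul, opTrace_mul_mul_star e f hf, h1, ← Complex.ofReal_mul,
    ← Complex.ofReal_add, Complex.ofReal_re, add_comm]
  simp only [Finset.mul_sum, ← Finset.sum_add_distrib, add_apply,
    one_apply_eq_self, inner_add_right, mul_assoc]

end Trace

/-! ### The infimum over operators -/

section Infimum

variable {H : Type*} [NormedAddCommGroup H] [InnerProductSpace ℂ H]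
  [FiniteDimensional ℂ H]
variable {ι κ : Type*} [Fintype ι] [Fintype κ]
  (e : OrthonormalBasis ι ℂ H) (f : OrthonormalBasis κ ℂ H)

theorem exists_operator_inner_eq (z : ι → κ → ℂ) :
    ∃ Z : H →L[ℂ] H, ∀ j k, inner ℂ (f k) (Z (e j)) = z j k := by
  classical
  refine ⟨LinearMap.toContinuousLinearMap (e.toBasis.constr ℂ fun j => ∑ k, z j k • f k),
    fun j k => ?_⟩
  have h1 : (e.toBasis.constr ℂ fun j => ∑ k, z j k • f k) (e j) = ∑ k, z j k • f k := by
    rw [← e.coe_toBasis, Module.Basis.constr_basis]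
  rw [LinearMap.coe_toContinuousLinearMap', h1, inner_sum]
  simp [inner_smul_right, orthonormal_iff_ite.1 f.orthonormal]

/-- Matrix entries of `Z` can be prescribed freely, so the termwise lower bounds are attained
simultaneously. -/
theorem iInf_decoupled {F : (H →L[ℂ] H) → ℝ} {A B : ι → κ → ℝ}
    (hA : ∀ j k, 0 ≤ A j k) (hB : ∀ j k, 0 ≤ B j k)
    (hF : ∀ Z, F Z = ∑ j, ∑ k, (A j k * ‖inner ℂ (f k) (Z (e j))‖ ^ 2 +
      B j k * ‖inner ℂ (f k) (e j) + inner ℂ (f k) (Z (e j))‖ ^ 2)) :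
    ⨅ Z, F Z = ∑ j, ∑ k, ‖inner ℂ (f k) (e j)‖ ^ 2 * (A j k * B j k / (A j k + B j k)) := by
  have hlow : ∀ Z, ∑ j, ∑ k, ‖inner ℂ (f k) (e j)‖ ^ 2 * (A j k * B j k / (A j k + B j k)) ≤
      F Z := fun Z => by
    rw [hF]
    exact Finset.sum_le_sum fun j _ => Finset.sum_le_sum fun k _ =>
      sq_mul_div_add_le (hA j k) (hB j k) _ _
  refine le_antisymm ?_ (le_ciInf hlow)
  obtain ⟨Z, hZ⟩ := exists_operator_inner_eq e f fun j k =>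
    ((-(B j k / (A j k + B j k)) : ℝ) : ℂ) * inner ℂ (f k) (e j)
  refine (ciInf_le ⟨_, forall_mem_range.2 hlow⟩ Z).trans_eq ?_
  rw [hF]
  refine Finset.sum_congr rfl fun j _ => Finset.sum_congr rfl fun k _ => ?_
  rw [hZ, sq_mul_div_add_eq (hA j k) (hB j k)]

end Infimum

/-! ### Real powers of positive operators -/

section Powers

variable {H : Type*} [NormedAddCommGroup H] [InnerProductSpace ℂ H]
  [CompleteSpace H] [FiniteDimensional ℂ H]

/-- The spectrum is finite, so `f` may be replaced by a Lagrange interpolant, and for polynomials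
the claim is direct. -/
theorem cfc_apply_eigenvector (A : H →L[ℂ] H) (hA : IsSelfAdjoint A) (f : ℝ → ℝ) {a : ℝ} {v : H}
    (hv : A v = (a : ℂ) • v) : cfc f A v = (f a : ℂ) • v := by
  rcases eq_or_ne v 0 with rfl | hv0
  · simp
  have hev : Module.End.HasEigenvector (A : H →ₗ[ℂ] H) (a : ℂ) v :=
    Module.End.hasEigenvector_iff.2 ⟨Module.End.mem_eigenspace_iff.2 hv, hv0⟩
  have hspec : spectrum ℂ A = spectrum ℂ (A : H →ₗ[ℂ] H) :=
    AlgEquiv.spectrum_eq (Module.End.toContinuousLinearMap H) (A : H →ₗ[ℂ] H)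
  have hfin : (spectrum ℝ A).Finite := by
    rw [← spectrum.preimage_algebraMap ℂ, hspec]
    exact (Module.End.finite_spectrum _).preimage (FaithfulSMul.algebraMap_injective ℝ ℂ).injOn
  have ha : a ∈ spectrum ℝ A := by
    rw [← spectrum.preimage_algebraMap ℂ, hspec]
    exact Module.End.hasEigenvalue_iff_mem_spectrum.1
      (Module.End.hasEigenvalue_of_hasEigenvector hev)
  let p : Polynomial ℝ := Lagrange.interpolate hfin.toFinset id f
  have hp : ∀ x ∈ spectrum ℝ A, f x = p.eval x := fun x hx =>
    (Lagrange.eval_interpolate_at_node (v := id) f (Set.injOn_id _) (hfin.mem_toFinset.2 hx)).symm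
  rw [cfc_congr (fun x hx => hp x hx), cfc_polynomial p A, hp a ha]
  have hpow : ∀ q : Polynomial ℝ, Polynomial.aeval A q v = ((q.eval a : ℝ) : ℂ) • v := by
    intro q
    induction q using Polynomial.induction_on' with
    | add p q hp hq => simp [add_smul, hp, hq]
    | monomial n c =>
      have : (A ^ n) v = ((a : ℂ) ^ n) • v := by
        induction n with
        | zero => simp
        | succ n ih => rw [pow_succ', mul_apply_eq_comp, ih, map_smul, hv, smul_smul,
            pow_succ]
      simp only [Polynomial.aeval_monomial, Polynomial.eval_monomial, Complex.ofReal_mul,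
        Complex.ofReal_pow, mul_apply_eq_comp, this, Algebra.algebraMap_eq_smul_one]
      rw [mul_comm (c : ℂ), mul_smul]
      simp
  exact hpow p

theorem rpow_apply_eigenvector {A : H →L[ℂ] H} (hA : A.IsPositive) (s : ℝ) {a : ℝ} {v : H}
    (hv : A v = (a : ℂ) • v) : (A ^ s) v = ((a ^ s : ℝ) : ℂ) • v := by
  rw [CFC.rpow_eq_cfc_real ((ContinuousLinearMap.nonneg_iff_isPositive A).2 hA)]
  exact cfc_apply_eigenvector A hA.isSelfAdjoint _ hv

variable {ι κ : Type*} [Fintype ι] [Fintype κ]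
  (e : OrthonormalBasis ι ℂ H) (f : OrthonormalBasis κ ℂ H)
variable {ρ σ : H →L[ℂ] H} {a : ι → ℝ} {b : κ → ℝ}

theorem opTrace_rpow_mul_rpow (hρ : ρ.IsPositive) (hσ : σ.IsPositive)
    (he : ∀ j, ρ (e j) = (a j : ℂ) • e j) (hf : ∀ k, σ (f k) = (b k : ℂ) • f k) (r s : ℝ) :
    opTrace (ρ ^ r * σ ^ s) =
      ((∑ j, ∑ k, ‖inner ℂ (f k) (e j)‖ ^ 2 * (a j ^ r * b k ^ s) : ℝ) : ℂ) := by
  rw [opTrace_mul_comm, opTrace_eq_sum_inner e, Complex.ofReal_sum]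
  refine Finset.sum_congr rfl fun j _ => ?_
  have hS : (σ ^ s) (e j) = ∑ k, (inner ℂ (f k) (e j) * ((b k ^ s : ℝ) : ℂ)) • f k := by
    conv_lhs => rw [← f.sum_repr' (e j)]
    simp only [map_sum, map_smul, rpow_apply_eigenvector hσ s (hf _), smul_smul]
  rw [mul_apply_eq_comp, rpow_apply_eigenvector hρ r (he j), map_smul, inner_smul_right, hS,
    inner_sum, Finset.mul_sum, Complex.ofReal_sum]
  refine Finset.sum_congr rfl fun k _ => ?_
  have h1 : inner ℂ (f k) (e j) * inner ℂ (e j) (f k) = ((‖inner ℂ (f k) (e j)‖ ^ 2 : ℝ) : ℂ) := by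
    rw [← inner_conj_symm (e j) (f k), RCLike.mul_conj]
    push_cast
    rfl
  rw [inner_smul_right, Complex.ofReal_mul, ← h1]
  push_cast
  ring

end Powers

/-! ### The scalar inequality and limit -/

/-- The contribution of a pair of eigenvalues `a` of `ρ` and `b` of `σ` to `variationalBound`. -/
noncomputable def scalarBound (α : ℝ) {m : ℕ} (t w t' w' : Fin m → ℝ) (a b : ℝ) : ℝ :=
  Real.sin (α * Real.pi) / Real.pi * (∑ i, (w i / t i) * (a * (t i * b) / (a + t i * b))) +
    Real.sin (α * Real.pi) / Real.pi * (∑ i, (w' i / t' i) * (b * (t' i * a) / (b + t' i * a)))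

theorem sum_weight_div_node {m : ℕ} {t w : Fin m → ℝ} (ht : ∀ i, t i ∈ Ioo (0 : ℝ) 1) (a b : ℝ) :
    ∑ i, (w i / t i) * (a * (t i * b) / (a + t i * b)) =
      a * b * ∑ i, w i * (a + t i * b)⁻¹ := by
  rw [Finset.mul_sum]
  refine Finset.sum_congr rfl fun i _ => ?_
  have := (ht i).1.ne'
  rw [div_eq_mul_inv (a * (t i * b))]
  field_simp

theorem integral_const_mul_inv (a b β : ℝ) :
    ∫ t in (0 : ℝ)..1, (a * b * (a + t * b)⁻¹) * t ^ β =
      a * b * ∫ t in (0 : ℝ)..1, (a + t * b)⁻¹ * t ^ β := by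
  rw [← intervalIntegral.integral_const_mul]
  simp only [mul_assoc]

section Scalar

variable {α : ℝ} (hα : α ∈ Ioo (0 : ℝ) 1)
include hα

theorem rpow_mul_rpow_eq_integral' {a b : ℝ} (ha : 0 < a) (hb : 0 < b) :
    a ^ α * b ^ (1 - α) =
      Real.sin (α * Real.pi) / Real.pi *
          (a * b * ∫ t in (0 : ℝ)..1, (a + t * b)⁻¹ * t ^ (α - 1)) +
        Real.sin (α * Real.pi) / Real.pi *
          (b * a * ∫ t in (0 : ℝ)..1, (b + t * a)⁻¹ * t ^ (-α)) := by
  rw [← rpow_mul_rpow_eq_integral hα ha hb, mul_add, integral_const_mul_inv]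
  simp only [mul_comm a b, integral_const_mul_inv]

/-- Zero eigenvalues contribute nothing to either side because both exponents are positive; hence no
support condition is needed. -/
theorem scalarBound_of_eq_zero {m : ℕ} (t w t' w' : Fin m → ℝ) {a b : ℝ} (h : a = 0 ∨ b = 0) :
    scalarBound α t w t' w' a b = 0 ∧ a ^ α * b ^ (1 - α) = 0 := by
  have h1 := hα.1.ne'
  have h2 := (sub_pos.2 hα.2).ne'
  rcases h with rfl | rfl <;> simp [scalarBound, Real.zero_rpow, h1, h2]

theorem scalarBound_le {m : ℕ} {t w t' w' : Fin m → ℝ} (h : IsGaussJacobi (α - 1) t w)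
    (h' : IsGaussJacobi (-α) t' w') {a b : ℝ} (ha : 0 ≤ a) (hb : 0 ≤ b) :
    scalarBound α t w t' w' a b ≤ a ^ α * b ^ (1 - α) := by
  rcases ha.eq_or_lt' with h0 | ha
  · exact (scalarBound_of_eq_zero hα t w t' w' (.inl h0)).1.trans_le
      (scalarBound_of_eq_zero hα t w t' w' (.inl h0)).2.ge
  rcases hb.eq_or_lt' with h0 | hb
  · exact (scalarBound_of_eq_zero hα t w t' w' (.inr h0)).1.trans_le
      (scalarBound_of_eq_zero hα t w t' w' (.inr h0)).2.ge
  have hβ : -1 < α - 1 := by linarith [hα.1]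
  have hβ' : -1 < -α := by linarith [hα.2]
  have hsin : 0 ≤ Real.sin (α * Real.pi) / Real.pi :=
    div_nonneg (Real.sin_nonneg_of_nonneg_of_le_pi (mul_nonneg hα.1.le Real.pi_pos.le)
      (by nlinarith [hα.2, Real.pi_pos])) Real.pi_pos.le
  rw [rpow_mul_rpow_eq_integral' hα ha hb, scalarBound, sum_weight_div_node (h.node_mem hβ),
    sum_weight_div_node (h'.node_mem hβ')]
  have h1 := h.sum_inv_le hβ ha hb
  have h2 := h'.sum_inv_le hβ' hb ha
  gcongr

theorem tendsto_scalarBound {t w t' w' : (m : ℕ) → Fin m → ℝ}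
    (h : ∀ m, IsGaussJacobi (α - 1) (t m) (w m)) (h' : ∀ m, IsGaussJacobi (-α) (t' m) (w' m))
    {a b : ℝ} (ha : 0 ≤ a) (hb : 0 ≤ b) :
    Tendsto (fun m => scalarBound α (t m) (w m) (t' m) (w' m) a b) atTop
      (𝓝 (a ^ α * b ^ (1 - α))) := by
  rcases ha.eq_or_lt' with h0 | ha
  · simp only [fun m => scalarBound_of_eq_zero hα (t m) (w m) (t' m) (w' m) (.inl h0 : a = 0 ∨ b = 0),
      (scalarBound_of_eq_zero hα (t 0) (w 0) (t' 0) (w' 0) (.inl h0 : a = 0 ∨ b = 0)).2,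
      tendsto_const_nhds]
  rcases hb.eq_or_lt' with h0 | hb
  · simp only [fun m => scalarBound_of_eq_zero hα (t m) (w m) (t' m) (w' m) (.inr h0 : a = 0 ∨ b = 0),
      (scalarBound_of_eq_zero hα (t 0) (w 0) (t' 0) (w' 0) (.inr h0 : a = 0 ∨ b = 0)).2,
      tendsto_const_nhds]
  have hβ : -1 < α - 1 := by linarith [hα.1]
  have hβ' : -1 < -α := by linarith [hα.2]
  have hcont : ∀ {a b : ℝ}, 0 < a → 0 < b →
      ContinuousOn (fun t : ℝ => (a + t * b)⁻¹) (Icc 0 1) := fun ha hb =>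
    ContinuousOn.inv₀ (by fun_prop) fun x hx => by have := hx.1; positivity
  simp only [scalarBound, fun m => sum_weight_div_node (w := w m) ((h m).node_mem hβ) a b,
    fun m => sum_weight_div_node (w := w' m) ((h' m).node_mem hβ') b a]
  rw [rpow_mul_rpow_eq_integral' hα ha hb]
  exact (((tendsto_gaussJacobi hβ h (hcont ha hb)).const_mul _).const_mul _).add
    (((tendsto_gaussJacobi hβ' h' (hcont hb ha)).const_mul _).const_mul _)

end Scalar

/-! ### Assembly -/

theorem variationalBound_eq {H : Type*} [NormedAddCommGroup H] [InnerProductSpace ℂ H]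
    [CompleteSpace H] [FiniteDimensional ℂ H] {ι κ : Type*} [Fintype ι] [Fintype κ]
    (e : OrthonormalBasis ι ℂ H) (f : OrthonormalBasis κ ℂ H) {ρ σ : H →L[ℂ] H}
    {a : ι → ℝ} {b : κ → ℝ} (he : ∀ j, ρ (e j) = (a j : ℂ) • e j)
    (hf : ∀ k, σ (f k) = (b k : ℂ) • f k) (ha : ∀ j, 0 ≤ a j) (hb : ∀ k, 0 ≤ b k)
    (α : ℝ) {m : ℕ} {t w t' w' : Fin m → ℝ} (ht : ∀ i, 0 ≤ t i) (ht' : ∀ i, 0 ≤ t' i) :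
    variationalBound ρ σ α t w t' w' =
      ∑ j, ∑ k, ‖inner ℂ (f k) (e j)‖ ^ 2 * scalarBound α t w t' w' (a j) (b k) := by
  have h1 : ∀ i, ⨅ Z, objective₁ ρ σ (t i) Z = ∑ j, ∑ k, ‖inner ℂ (f k) (e j)‖ ^ 2 *
      (a j * (t i * b k) / (a j + t i * b k)) := fun i =>
    iInf_decoupled e f (A := fun j _ => a j) (B := fun _ k => t i * b k) (fun j _ => ha j)
      (fun _ k => mul_nonneg (ht i) (hb k)) (objective₁_eq e f he hf (t i))
  have h2 : ∀ i, ⨅ Z, objective₂ ρ σ (t' i) Z = ∑ j, ∑ k, ‖inner ℂ (f k) (e j)‖ ^ 2 *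
      (b k * (t' i * a j) / (b k + t' i * a j)) := fun i =>
    iInf_decoupled e f (A := fun _ k => b k) (B := fun j _ => t' i * a j) (fun _ k => hb k)
      (fun j _ => mul_nonneg (ht' i) (ha j)) (objective₂_eq e f he hf (t' i))
  have hswap : ∀ (c : ℝ) (u : Fin m → ℝ) (g : Fin m → ι → κ → ℝ),
      c * ∑ i, u i * ∑ j, ∑ k, ‖inner ℂ (f k) (e j)‖ ^ 2 * g i j k =
        ∑ j, ∑ k, ‖inner ℂ (f k) (e j)‖ ^ 2 * (c * ∑ i, u i * g i j k) := by
    intro c u g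
    simp only [Finset.mul_sum]
    rw [Finset.sum_comm]
    refine Finset.sum_congr rfl fun j _ => ?_
    rw [Finset.sum_comm]
    refine Finset.sum_congr rfl fun k _ => Finset.sum_congr rfl fun i _ => ?_
    ring
  simp only [variationalBound, scalarBound, h1, h2, hswap, mul_add, Finset.sum_add_distrib]

theorem ContinuousLinearMap.IsPositive.exists_eigenbasis {H : Type*} [NormedAddCommGroup H]
    [InnerProductSpace ℂ H] [FiniteDimensional ℂ H] {ρ : H →L[ℂ] H} (hρ : ρ.IsPositive) :
    ∃ (e : OrthonormalBasis (Fin (Module.finrank ℂ H)) ℂ H) (a : Fin (Module.finrank ℂ H) → ℝ),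
      (∀ j, ρ (e j) = (a j : ℂ) • e j) ∧ ∀ j, 0 ≤ a j := by
  have hpos := (ContinuousLinearMap.isPositive_toLinearMap_iff _).2 hρ
  exact ⟨hpos.isSymmetric.eigenvectorBasis rfl, hpos.isSymmetric.eigenvalues rfl,
    hpos.isSymmetric.apply_eigenvectorBasis rfl, hpos.nonneg_eigenvalues rfl⟩

theorem theorem1 {H : Type*} [NormedAddCommGroup H] [InnerProductSpace ℂ H] [CompleteSpace H]
    [FiniteDimensional ℂ H] (ρ σ : H →L[ℂ] H) (hρ : ρ.IsPositive) (hσ : σ.IsPositive)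
    (α : ℝ) (hα : α ∈ Set.Ioo (0 : ℝ) 1) :
    (∀ m : ℕ, ∃ t w t' w' : Fin m → ℝ,
      IsGaussJacobi (α - 1) t w ∧ IsGaussJacobi (-α) t' w') ∧
    (∀ (m : ℕ) (t w t' w' : Fin m → ℝ),
      IsGaussJacobi (α - 1) t w → IsGaussJacobi (-α) t' w' →
        (∀ i, t i ∈ Set.Ioo (0 : ℝ) 1 ∧ t' i ∈ Set.Ioo (0 : ℝ) 1 ∧ 0 < w i ∧ 0 < w' i) ∧
        ((variationalBound ρ σ α t w t' w' : ℝ) : ℂ) ≤ opTrace (ρ ^ α * σ ^ (1 - α))) ∧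
    (∀ t w t' w' : (m : ℕ) → Fin m → ℝ,
      (∀ m, IsGaussJacobi (α - 1) (t m) (w m)) → (∀ m, IsGaussJacobi (-α) (t' m) (w' m)) →
        Tendsto (fun m : ℕ => ((variationalBound ρ σ α (t m) (w m) (t' m) (w' m) : ℝ) : ℂ)) atTop
          (𝓝 (opTrace (ρ ^ α * σ ^ (1 - α))))) := by

  have hβ : -1 < α - 1 := by linarith [hα.1]
  have hβ' : -1 < -α := by linarith [hα.2]
  obtain ⟨e, a, he, ha⟩ := hρ.exists_eigenbasis
  obtain ⟨f, b, hf, hb⟩ := hσ.exists_eigenbasis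
  have htrace := opTrace_rpow_mul_rpow e f hρ hσ he hf α (1 - α)
  have hbound : ∀ {m : ℕ} {t w t' w' : Fin m → ℝ}, IsGaussJacobi (α - 1) t w →
      IsGaussJacobi (-α) t' w' → variationalBound ρ σ α t w t' w' =
        ∑ j, ∑ k, ‖inner ℂ (f k) (e j)‖ ^ 2 * scalarBound α t w t' w' (a j) (b k) :=
    fun h h' => variationalBound_eq e f he hf ha hb α (fun i => (h.node_mem hβ i).1.le)
      fun i => (h'.node_mem hβ' i).1.le
  refine ⟨fun m => ?_, fun m t w t' w' h h' => ⟨fun i => ⟨h.node_mem hβ i, h'.node_mem hβ' i,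
    h.weight_pos hβ i, h'.weight_pos hβ' i⟩, ?_⟩, fun t w t' w' h h' => ?_⟩
  · obtain ⟨t, w, h⟩ := exists_isGaussJacobi hβ m
    obtain ⟨t', w', h'⟩ := exists_isGaussJacobi hβ' m
    exact ⟨t, w, t', w', h, h'⟩
  · rw [htrace, hbound h h', Complex.real_le_real]
    exact Finset.sum_le_sum fun j _ => Finset.sum_le_sum fun k _ =>
      mul_le_mul_of_nonneg_left (scalarBound_le hα h h' (ha j) (hb k)) (sq_nonneg _)
  · simp only [htrace, fun m => hbound (h m) (h' m)]
    refine (Complex.continuous_ofReal.tendsto _).comp ?_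
    exact tendsto_finsetSum _ fun j _ => tendsto_finsetSum _ fun k _ =>
      (tendsto_scalarBound hα h h' (ha j) (hb k)).const_mul _
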